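/- Identify $\mathbb R^3$ with $\mathbb R\times\mathbb C$, and define the Hopf map $h:\mathbb C^2\to\mathbb R\times\mathbb C$ by $h(w_1,w_2)=\big((|w_1|^2-|w_2|^2)/2,\;w_1\bar w_2\big)$ and $\sigma:\mathbb C^2\to\mathbb C^2$ by $\sigma(w_1,w_2)=(-\bar w_2,\bar w_1)$, so that $h(\sigma(w))=-h(w)$. The map $h$ is onto. Let $x_1,\dots,x_4$ be four distinct points of $\mathbb R^3$ and put $r_{ij}=|x_i-x_j|$. For each $i<j$ choose any $w_{ij}\in\mathbb C^2$ with $h(w_{ij})=x_j-x_i$, and put $w_{ji}=\sigma(w_{ij})$. Let $M$ be the $4\times4$ complex matrix whose $i$-th column consists of the coefficients of $1,T,T^2,T^3$ in the polynomial $\prod_{j\ne i}(a_{ij}+b_{ij}T)$, where $w_{ij}=(a_{ij},b_{ij})$. The number $\det M$ is the Atiyah determinant of the four points. Let $d_3(a,b,c)=(a+b-c)(b+c-a)(c+a-b)$, let $\operatorname{av}$ denote averaging a polynomial in the six variables $r_{ij}=r_{ji}$ over the action of the symmetric group $\mathcal S_4$ on the four indices, and let $$\begin{aligned} W={}&-r_{21}^4r_{43}^2-r_{21}^2r_{43}^4-r_{32}^2r_{41}^4-r_{32}^4r_{41}^2-r_{31}^4r_{42}^2-r_{31}^2r_{42}^4\\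 &+r_{21}^2r_{43}^2r_{31}^2+r_{21}^2r_{43}^2r_{41}^2-r_{21}^2r_{42}^2r_{41}^2+r_{21}^2r_{42}^2r_{43}^2+r_{21}^2r_{42}^2r_{31}^2+r_{21}^2r_{32}^2r_{43}^2\\ &-r_{21}^2r_{32}^2r_{31}^2+r_{32}^2r_{42}^2r_{41}^2+r_{31}^2r_{42}^2r_{41}^2+r_{32}^2r_{43}^2r_{41}^2-r_{32}^2r_{42}^2r_{43}^2+r_{32}^2r_{42}^2r_{31}^2\\ &+r_{31}^2r_{42}^2r_{43}^2+r_{32}^2r_{31}^2r_{41}^2-r_{31}^2r_{43}^2r_{41}^2+r_{21}^2r_{32}^2r_{41}^2 . \end{aligned}$$ **Theorem.** For any four distinct points in $\mathbb R^3$ and any choice of the lifts $w_{ij}$ ($i<j$), $\det M\neq0$. Moreover, if $V$ denotes the volume of the (possibly degenerate) tetrahedron with vertices $x_1,\dots,x_4$, then $144V^2=W$ and $$\begin{aligned}\operatorname{Re}(\det M)={}&64\,r_{21}r_{31}r_{32}r_{41}r_{42}r_{43}-4\,d_3(r_{21}r_{43},\,r_{31}r_{42},\,r_{32}r_{41})\\&+12\operatorname{av}\Big(r_{41}\big((r_{42}+r_{43})^2-r_{32}^2\big)\,d_3(r_{21},r_{31},r_{32})\Big)+288V^2.\end{aligned}$$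 With $288V^2$ replaced by $2W$, the right-hand side is a homogeneous polynomial of degree $6$ in the six variables $r_{ij}$, and it gives $\operatorname{Re}(\det M)$ for every such configuration. Furthermore, $$\operatorname{Re}(\det M)\ \ge\ 60\,r_{21}r_{31}r_{32}r_{41}r_{42}r_{43}\ >\ 0 .$$ -/

import Mathlib

namespace Atiyah

/-- Euclidean three-space, identified with `ℝ × ℂ` via `(t, a + b i) ↔ (t, a, b)`. -/
abbrev Space := EuclideanSpace ℝ (Fin 3)

/-- The Hopf map `(w₁, w₂) ↦ ((|w₁|² - |w₂|²)/2, w₁ * conj w₂)`, from `ℂ²` to `ℝ × ℂ`. -/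
noncomputable def hopf (w : ℂ × ℂ) : Space :=
  !₂[(‖w.1‖ ^ 2 - ‖w.2‖ ^ 2) / 2,
     (w.1 * (starRingEnd ℂ) w.2).re,
     (w.1 * (starRingEnd ℂ) w.2).im]

/-- The map `σ (w₁, w₂) = (- conj w₂, conj w₁)` on `ℂ²`. -/
noncomputable def sigma (w : ℂ × ℂ) : ℂ × ℂ :=
  (-(starRingEnd ℂ) w.2, (starRingEnd ℂ) w.1)

/-- `w i j`, for `i < j`, is a Hopf lift of the vector from the `i`-th point to the `j`-th point
(the later point viewed from the earlier one). The values `w i j` with `j ≤ i` are not used. -/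
def IsHopfLift {n : ℕ} (x : Fin n → Space) (w : Fin n → Fin n → ℂ × ℂ) : Prop :=
  ∀ i j : Fin n, i < j → hopf (w i j) = x j - x i

/-- The vector of `ℂ²` used for the view of the `j`-th point from the `i`-th one: the chosen lift
`w i j` if `j` is later than `i`, and `σ` of the lift `w j i` of the opposite vector otherwise. -/
noncomputable def view {n : ℕ} (w : Fin n → Fin n → ℂ × ℂ) (i j : Fin n) : ℂ × ℂ :=
  if i < j then w i j else sigma (w j i)

/-- The symmetric product of the `n - 1` views from the `i`-th point, as the polynomial
`∏_{j ≠ i} (a_j + b_j T)`, where `(a_j, b_j)` is the view of the `j`-th point. -/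
noncomputable def viewPoly {n : ℕ} (w : Fin n → Fin n → ℂ × ℂ) (i : Fin n) : Polynomial ℂ :=
  ∏ j ∈ Finset.univ.erase i,
    (Polynomial.C (view w i j).1 + Polynomial.C (view w i j).2 * Polynomial.X)

/-- The `n × n` matrix whose `i`-th column consists of the coefficients of
`1, T, …, T ^ (n - 1)` in `viewPoly w i`. -/
noncomputable def atiyahMatrix {n : ℕ} (w : Fin n → Fin n → ℂ × ℂ) : Matrix (Fin n) (Fin n) ℂ :=
  Matrix.of fun k i => (viewPoly w i).coeff (k : ℕ)

/-- The Atiyah determinant, computed from the chosen Hopf lifts `w`. -/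
noncomputable def atiyahDet {n : ℕ} (w : Fin n → Fin n → ℂ × ℂ) : ℂ :=
  (atiyahMatrix w).det

/-- `d₃(a, b, c) = (a + b - c)(b + c - a)(c + a - b)`. -/
def d3 {R : Type*} [CommRing R] (a b c : R) : R :=
  (a + b - c) * (b + c - a) * (c + a - b)

/-- The six edges of the tetrahedron with vertices `0, 1, 2, 3`. -/
abbrev Edge := {e : Sym2 (Fin 4) // ¬ e.IsDiag}

/-- The variable `r_{ij}` attached to the edge between two different vertices. -/
noncomputable def r (i j : Fin 4) (h : i ≠ j := by decide) : MvPolynomial Edge ℝ :=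
  MvPolynomial.X ⟨s(i, j), by simpa using h⟩

/-- The action of a permutation of the vertices on the edges. -/
def permEdge (g : Equiv.Perm (Fin 4)) (e : Edge) : Edge :=
  ⟨Sym2.map g e.1, by rw [Sym2.isDiag_map g.injective]; exact e.2⟩

/-- The average of a polynomial in the `r_{ij}` over the action of the symmetric group on the
four vertices. -/
noncomputable def av (p : MvPolynomial Edge ℝ) : MvPolynomial Edge ℝ :=
  MvPolynomial.C (1 / 24 : ℝ) * ∑ g : Equiv.Perm (Fin 4), MvPolynomial.rename (permEdge g) p

/-- The six edge lengths of four points. -/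
noncomputable def edgeLength (x : Fin 4 → Space) (e : Edge) : ℝ :=
  Sym2.lift ⟨fun i j => dist (x i) (x j), fun _ _ => dist_comm _ _⟩ e.1

/-- The volume of the tetrahedron spanned by four points. -/
noncomputable def tetraVolume (x : Fin 4 → Space) : ℝ :=
  MeasureTheory.volume.real (convexHull ℝ (Set.range x))

/-- The polynomial in the edge lengths that gives `144 V²`. -/
noncomputable def volPoly : MvPolynomial Edge ℝ :=
  - r 1 0 ^ 4 * r 3 2 ^ 2 - r 1 0 ^ 2 * r 3 2 ^ 4 - r 2 1 ^ 2 * r 3 0 ^ 4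
  - r 2 1 ^ 4 * r 3 0 ^ 2 - r 2 0 ^ 4 * r 3 1 ^ 2 - r 2 0 ^ 2 * r 3 1 ^ 4
  + r 1 0 ^ 2 * r 3 2 ^ 2 * r 2 0 ^ 2 + r 1 0 ^ 2 * r 3 2 ^ 2 * r 3 0 ^ 2
  - r 1 0 ^ 2 * r 3 1 ^ 2 * r 3 0 ^ 2 + r 1 0 ^ 2 * r 3 1 ^ 2 * r 3 2 ^ 2
  + r 1 0 ^ 2 * r 3 1 ^ 2 * r 2 0 ^ 2 + r 1 0 ^ 2 * r 2 1 ^ 2 * r 3 2 ^ 2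
  - r 1 0 ^ 2 * r 2 1 ^ 2 * r 2 0 ^ 2 + r 2 1 ^ 2 * r 3 1 ^ 2 * r 3 0 ^ 2
  + r 2 0 ^ 2 * r 3 1 ^ 2 * r 3 0 ^ 2 + r 2 1 ^ 2 * r 3 2 ^ 2 * r 3 0 ^ 2
  - r 2 1 ^ 2 * r 3 1 ^ 2 * r 3 2 ^ 2 + r 2 1 ^ 2 * r 3 1 ^ 2 * r 2 0 ^ 2
  + r 2 0 ^ 2 * r 3 1 ^ 2 * r 3 2 ^ 2 + r 2 1 ^ 2 * r 2 0 ^ 2 * r 3 0 ^ 2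
  - r 2 0 ^ 2 * r 3 2 ^ 2 * r 3 0 ^ 2 + r 1 0 ^ 2 * r 2 1 ^ 2 * r 3 0 ^ 2

/-- The polynomial that is averaged in the formula for the real part of the determinant. -/
noncomputable def facePoly : MvPolynomial Edge ℝ :=
  r 3 0 * ((r 3 1 + r 3 2) ^ 2 - r 2 1 ^ 2) * d3 (r 1 0) (r 2 0) (r 2 1)

/-- The polynomial in the six edge lengths that gives the real part of the determinant. -/
noncomputable def reDetPoly : MvPolynomial Edge ℝ :=
  64 * (r 1 0 * r 2 0 * r 2 1 * r 3 0 * r 3 1 * r 3 2)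
    - 4 * d3 (r 1 0 * r 3 2) (r 2 0 * r 3 1) (r 2 1 * r 3 0)
    + 12 * av facePoly
    + 2 * volPoly

/-- The Hopf map is onto. -/
theorem hopf_surjective : Function.Surjective hopf := by
  intro v
  obtain ⟨a, b, c, rfl⟩ : ∃ a b c : ℝ, v = !₂[a, b, c] :=
    ⟨v 0, v 1, v 2, by ext i; fin_cases i <;> rfl⟩
  set ρ : ℝ := √(a ^ 2 + b ^ 2 + c ^ 2) with hρ
  have hρ2 : ρ ^ 2 = a ^ 2 + b ^ 2 + c ^ 2 := Real.sq_sqrt (by positivity)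
  have hρ0 : 0 ≤ ρ := Real.sqrt_nonneg _
  by_cases h : 0 < ρ + a
  · set s : ℝ := √(ρ + a) with hs
    have hs2 : s ^ 2 = ρ + a := Real.sq_sqrt h.le
    have hs0 : 0 < s := Real.sqrt_pos.2 h
    refine ⟨((s : ℂ), ⟨b / s, -c / s⟩), ?_⟩
    ext i
    fin_cases i
    · simp only [hopf, ← Complex.normSq_eq_norm_sq, Complex.normSq_apply]
      simp
      field_simp
      have : s ^ 4 = (ρ + a) ^ 2 := by rw [← hs2]; ring
      rw [this, hs2]
      linear_combination hρ2
    · simp [hopf]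
      field_simp
    · simp [hopf]
      field_simp
  · have h1 : b ^ 2 + c ^ 2 ≤ 0 := by nlinarith
    have hb : b = 0 := by nlinarith [sq_nonneg b, sq_nonneg c]
    have hc : c = 0 := by nlinarith [sq_nonneg b, sq_nonneg c]
    have ha : 0 ≤ -2 * a := by linarith
    have hq : √(-2 * a) ^ 2 = -2 * a := Real.sq_sqrt ha
    subst hb hc
    refine ⟨(0, ((√(-2 * a) : ℝ) : ℂ)), ?_⟩
    ext i
    fin_cases i
    · simp only [hopf, ← Complex.normSq_eq_norm_sq, Complex.normSq_apply]
      simp only [Complex.ofReal_re, Complex.ofReal_im, ← pow_two, hq]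
      simp
    · simp [hopf]
    · simp [hopf]

/-- Hopf lifts exist for every configuration of points. -/
theorem exists_isHopfLift {n : ℕ} (x : Fin n → Space) : ∃ w, IsHopfLift x w :=
  ⟨fun i j => (hopf_surjective (x j - x i)).choose,
    fun i j _ => (hopf_surjective (x j - x i)).choose_spec⟩

end Atiyah

/-! Conjugating `det M` amounts to exchanging the lifts with their conjugates. The sum of `det M`
and its conjugate is a form of bidegree (1,1) in each lift and its conjugate, and it can be written
using only the lengths and scalar products of the six edge vectors (`cubicDet_add_cubicDet`,
`re_atiyahDet`). Polarization turns scalar products of edges into squared distances, and expansion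
gives `reDetPoly` (`re_atiyahDet_eq_eval`).

For the bound, let P be the product of the six distances. Schur's inequality says d₃(a, b, c) ≤ abc
(`d3_le_mul`); for the three products of opposite edges abc = P, so the first two terms are at least
64P - 4P. The averaged term is nonnegative by the triangle inequality (`faceValue_nonneg`), and so
is 288V². As P > 0, the determinant cannot vanish.

The identity 144V² = W compares a Gram determinant in squared distances with the simplex volume
|det| / n! (`eval_volPoly`, `volume_convexHull_range`). -/

namespace Atiyah

/-! ### The real part as a form in the edge vectors -/

/-- The real part of the Atiyah determinant of four points as a polynomial in the lengths `r e`
and the scalar products `d e f` of the six edge vectors, the edges `01, 02, 03, 12, 13, 23` being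
numbered from `0` to `5`. -/
def edgeForm {R : Type*} [CommRing R] (r : Fin 6 → R) (d : Fin 6 → Fin 6 → R) : R :=
  24 * (r 0 * r 1 * r 2 * r 3 * r 4 * r 5)
    + 8 * (d 0 1 * r 2 * r 3 * r 4 * r 5 + d 0 2 * r 1 * r 3 * r 4 * r 5
      - d 0 3 * r 1 * r 2 * r 4 * r 5 - d 0 4 * r 1 * r 2 * r 3 * r 5
      + d 1 2 * r 0 * r 3 * r 4 * r 5 + d 1 3 * r 0 * r 2 * r 4 * r 5
      - d 1 5 * r 0 * r 2 * r 3 * r 4 + d 2 4 * r 0 * r 1 * r 3 * r 5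
      + d 2 5 * r 0 * r 1 * r 3 * r 4 + d 3 4 * r 0 * r 1 * r 2 * r 5
      - d 3 5 * r 0 * r 1 * r 2 * r 4 + d 4 5 * r 0 * r 1 * r 2 * r 3)
    + 4 * (d 0 2 * d 1 3 * r 4 * r 5 - d 0 3 * d 1 2 * r 4 * r 5 + d 0 1 * d 2 4 * r 3 * r 5
      - d 0 4 * d 1 2 * r 3 * r 5 + d 0 1 * d 2 5 * r 3 * r 4
      - d 0 2 * d 1 5 * r 3 * r 4 + d 0 1 * d 3 4 * r 2 * r 5
      - d 0 4 * d 1 3 * r 2 * r 5 - d 0 1 * d 3 5 * r 2 * r 4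
      + d 0 3 * d 1 5 * r 2 * r 4 + 2 * (d 0 5 * d 1 4 * r 2 * r 3)
      + d 0 2 * d 3 4 * r 1 * r 5 - d 0 3 * d 2 4 * r 1 * r 5
      - 2 * (d 0 5 * d 2 3 * r 1 * r 4) + d 0 2 * d 4 5 * r 1 * r 3
      - d 0 4 * d 2 5 * r 1 * r 3 - d 0 3 * d 4 5 * r 1 * r 2
      + d 0 4 * d 3 5 * r 1 * r 2 + 2 * (d 1 4 * d 2 3 * r 0 * r 5)
      - d 1 2 * d 3 5 * r 0 * r 4 + d 1 3 * d 2 5 * r 0 * r 4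
      + d 1 2 * d 4 5 * r 0 * r 3 - d 1 5 * d 2 4 * r 0 * r 3
      + d 1 3 * d 4 5 * r 0 * r 2 - d 1 5 * d 3 4 * r 0 * r 2
      - d 2 4 * d 3 5 * r 0 * r 1 + d 2 5 * d 3 4 * r 0 * r 1)
    + 4 * (-(d 0 1 * d 2 4 * d 3 5) + d 0 1 * d 2 5 * d 3 4 + d 0 2 * d 1 3 * d 4 5
      - d 0 2 * d 1 5 * d 3 4 - d 0 3 * d 1 2 * d 4 5 + d 0 3 * d 1 5 * d 2 4
      + d 0 4 * d 1 2 * d 3 5 - d 0 4 * d 1 3 * d 2 5)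

/-- The coefficients of `(u₁ + u₂ T)(v₁ + v₂ T)(w₁ + w₂ T)`. -/
def cubicCoeff {R : Type*} [CommRing R] (u v w : R × R) : Fin 4 → R :=
  ![u.1 * v.1 * w.1, u.1 * v.1 * w.2 + u.1 * v.2 * w.1 + u.2 * v.1 * w.1,
    u.1 * v.2 * w.2 + u.2 * v.1 * w.2 + u.2 * v.2 * w.1, u.2 * v.2 * w.2]

/-- The Atiyah determinant of four points, as a polynomial in the coordinates of the six lifts
and in their conjugates. -/
def cubicDet {R : Type*} [CommRing R] (u v : Fin 6 → R × R) : R :=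
  Matrix.det (Matrix.of fun k i =>
    ![cubicCoeff (u 0) (u 1) (u 2),
      cubicCoeff (-(v 0).2, (v 0).1) (u 3) (u 4),
      cubicCoeff (-(v 1).2, (v 1).1) (-(v 3).2, (v 3).1) (u 5),
      cubicCoeff (-(v 2).2, (v 2).1) (-(v 4).2, (v 4).1) (-(v 5).2, (v 5).1)] i k)

theorem det_fin_four {R : Type*} [CommRing R] (A : Matrix (Fin 4) (Fin 4) R) :
    A.det =
      (A 0 0 * A 1 1 - A 0 1 * A 1 0) * (A 2 2 * A 3 3 - A 2 3 * A 3 2)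
      - (A 0 0 * A 1 2 - A 0 2 * A 1 0) * (A 2 1 * A 3 3 - A 2 3 * A 3 1)
      + (A 0 0 * A 1 3 - A 0 3 * A 1 0) * (A 2 1 * A 3 2 - A 2 2 * A 3 1)
      + (A 0 1 * A 1 2 - A 0 2 * A 1 1) * (A 2 0 * A 3 3 - A 2 3 * A 3 0)
      - (A 0 1 * A 1 3 - A 0 3 * A 1 1) * (A 2 0 * A 3 2 - A 2 2 * A 3 0)
      + (A 0 2 * A 1 3 - A 0 3 * A 1 2) * (A 2 0 * A 3 1 - A 2 1 * A 3 0) := by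
  simp only [Matrix.det_succ_row_zero A, Matrix.det_fin_three, Fin.sum_univ_four,
    Matrix.submatrix_apply]
  simp [Fin.succAbove, Fin.lt_def]
  ring

/-- With the conjugates as independent variables `v`, this is a polynomial identity over any
commutative ring. At `v = star u` the entries on the right are twice the lengths and four times the
scalar products of the Hopf images. -/
theorem cubicDet_add_cubicDet {R : Type*} [CommRing R] (u v : Fin 6 → R × R) :
    32 * (cubicDet u v + cubicDet v u) =
      edgeForm (fun e => (u e).1 * (v e).1 + (u e).2 * (v e).2)
        (fun e f => ((u e).1 * (v e).1 - (u e).2 * (v e).2) *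
            ((u f).1 * (v f).1 - (u f).2 * (v f).2) +
          2 * ((u e).1 * (v e).2 * ((u f).2 * (v f).1) +
            (u e).2 * (v e).1 * ((u f).1 * (v f).2))) := by
  simp only [cubicDet, edgeForm, det_fin_four, cubicCoeff, Matrix.of_apply, Matrix.cons_val]
  generalize u 0 = u0, u 1 = u1, u 2 = u2, u 3 = u3, u 4 = u4, u 5 = u5,
    v 0 = v0, v 1 = v1, v 2 = v2, v 3 = v3, v 4 = v4, v 5 = v5
  obtain ⟨a0, b0⟩ := u0
  obtain ⟨a1, b1⟩ := u1
  obtain ⟨a2, b2⟩ := u2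
  obtain ⟨a3, b3⟩ := u3
  obtain ⟨a4, b4⟩ := u4
  obtain ⟨a5, b5⟩ := u5
  obtain ⟨c0, d0⟩ := v0
  obtain ⟨c1, d1⟩ := v1
  obtain ⟨c2, d2⟩ := v2
  obtain ⟨c3, d3⟩ := v3
  obtain ⟨c4, d4⟩ := v4
  obtain ⟨c5, d5⟩ := v5
  dsimp only
  ring
theorem coeff_prod_three (u v w : ℂ × ℂ) (k : Fin 4) :
    ((Polynomial.C u.1 + Polynomial.C u.2 * Polynomial.X) *
      ((Polynomial.C v.1 + Polynomial.C v.2 * Polynomial.X) *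
        (Polynomial.C w.1 + Polynomial.C w.2 * Polynomial.X))).coeff (k : ℕ) =
      cubicCoeff u v w k := by
  have h : (Polynomial.C u.1 + Polynomial.C u.2 * Polynomial.X) *
      ((Polynomial.C v.1 + Polynomial.C v.2 * Polynomial.X) *
        (Polynomial.C w.1 + Polynomial.C w.2 * Polynomial.X)) =
      Polynomial.C (cubicCoeff u v w 0) + Polynomial.C (cubicCoeff u v w 1) * Polynomial.X
        + Polynomial.C (cubicCoeff u v w 2) * Polynomial.X ^ 2
        + Polynomial.C (cubicCoeff u v w 3) * Polynomial.X ^ 3 := by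
    simp only [cubicCoeff, Matrix.cons_val, map_add, map_mul]
    ring
  rw [h]
  fin_cases k <;> simp [Polynomial.coeff_X, Polynomial.coeff_C]

/-- The six lifts, in the order `01, 02, 03, 12, 13, 23` of the edges. -/
def edgeLift (w : Fin 4 → Fin 4 → ℂ × ℂ) : Fin 6 → ℂ × ℂ :=
  ![w 0 1, w 0 2, w 0 3, w 1 2, w 1 3, w 2 3]

theorem atiyahDet_eq_cubicDet (w : Fin 4 → Fin 4 → ℂ × ℂ) :
    atiyahDet w = cubicDet (edgeLift w) (fun e => star (edgeLift w e)) := by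
  have h0 : Finset.univ.erase (0 : Fin 4) = {1, 2, 3} := by decide
  have h1 : Finset.univ.erase (1 : Fin 4) = {0, 2, 3} := by decide
  have h2 : Finset.univ.erase (2 : Fin 4) = {0, 1, 3} := by decide
  have h3 : Finset.univ.erase (3 : Fin 4) = {0, 1, 2} := by decide
  unfold atiyahDet cubicDet
  congr 1
  ext k i
  simp only [atiyahMatrix, Matrix.of_apply, viewPoly]
  fin_cases i
  all_goals
    simp only [Fin.zero_eta, Fin.mk_one, Fin.reduceFinMk, h0, h1, h2, h3]
    rw [Finset.prod_insert (by decide), Finset.prod_insert (by decide), Finset.prod_singleton,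
      coeff_prod_three]
    simp [view, sigma, edgeLift]

theorem norm_hopf (u : ℂ × ℂ) : ‖hopf u‖ = (‖u.1‖ ^ 2 + ‖u.2‖ ^ 2) / 2 := by
  have h : ∑ i, ‖(hopf u).ofLp i‖ ^ 2 = ((‖u.1‖ ^ 2 + ‖u.2‖ ^ 2) / 2) ^ 2 := by
    simp only [hopf, ← Complex.normSq_eq_norm_sq, Complex.normSq_apply]
    simp [Fin.sum_univ_three]
    ring
  rw [EuclideanSpace.norm_eq, h, Real.sqrt_sq (by positivity)]

theorem inner_hopf (u v : ℂ × ℂ) :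
    ((inner ℝ (hopf u) (hopf v) : ℝ) : ℂ) =
      ((u.1 * star u.1 - u.2 * star u.2) * (v.1 * star v.1 - v.2 * star v.2) +
        2 * (u.1 * star u.2 * (v.2 * star v.1) + u.2 * star u.1 * (v.1 * star v.2))) / 4 := by
  simp only [hopf, ← Complex.normSq_eq_norm_sq, Complex.normSq_apply]
  apply Complex.ext <;> simp [Fin.sum_univ_three, PiLp.inner_apply] <;> ring

theorem cubicDet_star (u v : Fin 6 → ℂ × ℂ) :
    cubicDet (fun e => star (u e)) (fun e => star (v e)) = star (cubicDet u v) := by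
  simp [cubicDet, det_fin_four, cubicCoeff]

/-- Each monomial involves each of the six edges exactly once, a length carrying one edge and a
scalar product two; hence the factor 2⁶. -/
theorem edgeForm_smul {R : Type*} [CommRing R] (r : Fin 6 → R) (d : Fin 6 → Fin 6 → R) :
    edgeForm (fun e => 2 * r e) (fun e f => 4 * d e f) = 64 * edgeForm r d := by
  simp only [edgeForm]
  ring

theorem ofReal_edgeForm (r : Fin 6 → ℝ) (d : Fin 6 → Fin 6 → ℝ) :
    ((edgeForm r d : ℝ) : ℂ) = edgeForm (fun e => (r e : ℂ)) (fun e f => (d e f : ℂ)) := by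
  simp only [edgeForm]
  push_cast
  rfl

theorem re_atiyahDet (w : Fin 4 → Fin 4 → ℂ × ℂ) :
    (atiyahDet w).re = edgeForm (fun e => ‖hopf (edgeLift w e)‖)
      (fun e f => inner ℝ (hopf (edgeLift w e)) (hopf (edgeLift w f))) := by
  set u := edgeLift w with hu
  have h := cubicDet_add_cubicDet u (fun e => star (u e))
  have hs := cubicDet_star u (fun e => star (u e))
  simp only [star_star] at hs
  rw [hs, ← atiyahDet_eq_cubicDet] at h
  have hr (e) : (u e).1 * (star (u e)).1 + (u e).2 * (star (u e)).2 = 2 * (‖hopf (u e)‖ : ℂ) := by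
    rw [norm_hopf]
    simp [Complex.mul_conj']
    ring
  have hd (e f) : ((u e).1 * (star (u e)).1 - (u e).2 * (star (u e)).2) *
            ((u f).1 * (star (u f)).1 - (u f).2 * (star (u f)).2) +
          2 * ((u e).1 * (star (u e)).2 * ((u f).2 * (star (u f)).1) +
            (u e).2 * (star (u e)).1 * ((u f).1 * (star (u f)).2)) =
      4 * ((inner ℝ (hopf (u e)) (hopf (u f)) : ℝ) : ℂ) := by
    rw [inner_hopf]
    simp
    ring
  simp only [hr, hd] at h
  rw [edgeForm_smul, ← ofReal_edgeForm] at h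
  have h' := congrArg Complex.re h
  simp at h'
  linarith
-- From scalar products to edge lengths
theorem inner_sub_sub_eq_dist {E : Type*} [NormedAddCommGroup E] [InnerProductSpace ℝ E]
    (a b c d : E) :
    inner ℝ (b - a) (d - c) =
      (dist d a ^ 2 + dist c b ^ 2 - dist c a ^ 2 - dist d b ^ 2) / 2 := by
  simp only [dist_eq_norm, ← real_inner_self_eq_norm_sq, inner_sub_left, inner_sub_right,
    real_inner_comm]
  ring

theorem eval_r (x : Fin 4 → Space) (i j : Fin 4) (h : i ≠ j) :
    MvPolynomial.eval (edgeLength x) (r i j h) = dist (x i) (x j) := by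
  simp [r, edgeLength]

theorem rename_r (g : Equiv.Perm (Fin 4)) (i j : Fin 4) (h : i ≠ j) :
    MvPolynomial.rename (permEdge g) (r i j h) = r (g i) (g j) (g.injective.ne h) := by
  simp [r, permEdge]

theorem map_d3 {R S : Type*} [CommRing R] [CommRing S] (f : R →+* S) (a b c : R) :
    f (d3 a b c) = d3 (f a) (f b) (f c) := by
  simp [d3]

/-- The value of `facePoly` at the edge lengths of `x`. -/
noncomputable def faceValue (x : Fin 4 → Space) : ℝ :=
  dist (x 3) (x 0) * ((dist (x 3) (x 1) + dist (x 3) (x 2)) ^ 2 - dist (x 2) (x 1) ^ 2) *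
    d3 (dist (x 1) (x 0)) (dist (x 2) (x 0)) (dist (x 2) (x 1))

theorem eval_av_facePoly (x : Fin 4 → Space) :
    MvPolynomial.eval (edgeLength x) (av facePoly) =
      1 / 24 * ∑ g : Equiv.Perm (Fin 4), faceValue (x ∘ g) := by
  simp only [av, map_mul, MvPolynomial.eval_C, map_sum]
  congr 1
  refine Finset.sum_congr rfl fun g _ => ?_
  -- `map_d3` is stated for ring homomorphisms, so `rename` is viewed as one.
  rw [← AlgHom.coe_toRingHom]
  simp only [facePoly, map_mul, map_sub, map_add, map_pow, map_d3]
  simp only [AlgHom.coe_toRingHom, rename_r, eval_r, faceValue, Function.comp]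

theorem sum_perm_fin_four {M : Type*} [AddCommMonoid M] (f : Fin 4 → Fin 4 → Fin 4 → Fin 4 → M) :
    ∑ g : Equiv.Perm (Fin 4), f (g 0) (g 1) (g 2) (g 3) =
      f 0 1 2 3 + f 0 1 3 2 + f 0 2 1 3 + f 0 2 3 1 + f 0 3 1 2 + f 0 3 2 1 +
      (f 1 0 2 3 + f 1 0 3 2 + f 1 2 0 3 + f 1 2 3 0 + f 1 3 0 2 + f 1 3 2 0) +
      (f 2 0 1 3 + f 2 0 3 1 + f 2 1 0 3 + f 2 1 3 0 + f 2 3 0 1 + f 2 3 1 0) +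
      (f 3 0 1 2 + f 3 0 2 1 + f 3 1 0 2 + f 3 1 2 0 + f 3 2 0 1 + f 3 2 1 0) := by
  have h : ∑ g : Equiv.Perm (Fin 4), f (g 0) (g 1) (g 2) (g 3) =
      ∑ t ∈ Finset.univ.image (fun g : Equiv.Perm (Fin 4) => (g 0, g 1, g 2, g 3)),
        f t.1 t.2.1 t.2.2.1 t.2.2.2 := by
    rw [Finset.sum_image]
    intro g _ g' _ h
    ext i
    simp only [Prod.mk.injEq] at h
    fin_cases i <;> simp [h]
  have h' : Finset.univ.image (fun g : Equiv.Perm (Fin 4) => (g 0, g 1, g 2, g 3)) =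
      {(0, 1, 2, 3), (0, 1, 3, 2), (0, 2, 1, 3), (0, 2, 3, 1), (0, 3, 1, 2), (0, 3, 2, 1),
       (1, 0, 2, 3), (1, 0, 3, 2), (1, 2, 0, 3), (1, 2, 3, 0), (1, 3, 0, 2), (1, 3, 2, 0),
       (2, 0, 1, 3), (2, 0, 3, 1), (2, 1, 0, 3), (2, 1, 3, 0), (2, 3, 0, 1), (2, 3, 1, 0),
       (3, 0, 1, 2), (3, 0, 2, 1), (3, 1, 0, 2), (3, 1, 2, 0), (3, 2, 0, 1), (3, 2, 1, 0)} := by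
    decide +kernel
  rw [h, h']
  iterate 23 rw [Finset.sum_insert (by decide)]
  rw [Finset.sum_singleton]
  ac_rfl

/-- The squared determinant is the Gram determinant of the edge vectors at `x 0`, whose entries are
polynomials in squared distances. -/
theorem eval_volPoly (x : Fin 4 → Space) :
    MvPolynomial.eval (edgeLength x) volPoly =
      4 * Matrix.det (Matrix.of fun i j => x (Fin.succ j) i - x 0 i) ^ 2 := by
  simp only [volPoly, map_add, map_sub, map_neg, map_mul, map_pow, eval_r, EuclideanSpace.dist_eq]
  simp only [Matrix.det_fin_three, Matrix.of_apply, Fin.sum_univ_three, Real.dist_eq, sq_abs]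
  have h4 (a : ℝ) : √a ^ 4 = (√a ^ 2) ^ 2 := by ring
  simp only [h4]
  repeat rw [Real.sq_sqrt (by positivity)]
  simp only [Fin.reduceSucc, Fin.succ_zero_eq_one, Fin.succ_one_eq_two]
  -- Moving the origin to `x 0` removes its coordinates from every difference.
  obtain ⟨y, hy⟩ : ∃ y : Fin 4 → Fin 3 → ℝ, ∀ k i, x k i = y k i + x 0 i :=
    ⟨fun k i => x k i - x 0 i, fun k i => by ring⟩
  simp only [hy 1, hy 2, hy 3, add_sub_cancel_right,
    add_sub_add_right_eq_sub]
  ring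

theorem re_atiyahDet_eq_eval (x : Fin 4 → Space) (w : Fin 4 → Fin 4 → ℂ × ℂ)
    (hw : IsHopfLift x w) :
    (atiyahDet w).re = MvPolynomial.eval (edgeLength x) reDetPoly := by
  have h01 := hw 0 1 (by decide)
  have h02 := hw 0 2 (by decide)
  have h03 := hw 0 3 (by decide)
  have h12 := hw 1 2 (by decide)
  have h13 := hw 1 3 (by decide)
  have h23 := hw 2 3 (by decide)
  rw [re_atiyahDet]
  simp only [edgeForm, edgeLift, Matrix.cons_val, h01, h02, h03, h12, h13, h23,
    inner_sub_sub_eq_dist]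
  simp only [← dist_eq_norm]
  simp only [reDetPoly, volPoly, map_add, map_sub, map_neg, map_mul, map_pow, map_d3, eval_r,
    map_ofNat, eval_av_facePoly, faceValue, Function.comp_apply]
  rw [sum_perm_fin_four fun a b c d => dist (x d) (x a) * ((dist (x d) (x b) + dist (x d) (x c)) ^ 2
    - dist (x c) (x b) ^ 2) * d3 (dist (x b) (x a)) (dist (x c) (x a)) (dist (x c) (x b))]
  simp only [dist_self, d3, dist_comm (x 0) (x 1), dist_comm (x 0) (x 2), dist_comm (x 0) (x 3),
    dist_comm (x 1) (x 2), dist_comm (x 1) (x 3), dist_comm (x 2) (x 3)]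
  -- The six distances act as independent variables here: no relation among them is needed.
  ring

end Atiyah

/-! ### Volume of a simplex -/

open MeasureTheory in
-- Slicing at first coordinate t leaves a corner simplex of size s - t in one dimension less, so the
-- induction needs all sizes s, and the volume is the integral of (s - t)ⁿ / n!.
theorem MeasureTheory.volume_corner_simplex (n : ℕ) {s : ℝ} (hs : 0 ≤ s) :
    volume {y : Fin n → ℝ | (∀ i, 0 ≤ y i) ∧ ∑ i, y i ≤ s} =
      ENNReal.ofReal (s ^ n / n.factorial) := by
  induction n generalizing s with
  | zero => simp [hs, volume_pi]
  | succ n ih =>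
    set B : Set (ℝ × (Fin n → ℝ)) :=
      {p | 0 ≤ p.1 ∧ (∀ i, 0 ≤ p.2 i) ∧ p.1 + ∑ i, p.2 i ≤ s} with hB
    have hpre : {y : Fin (n + 1) → ℝ | (∀ i, 0 ≤ y i) ∧ ∑ i, y i ≤ s} =
        MeasurableEquiv.piFinSuccAbove (fun _ => ℝ) 0 ⁻¹' B := by
      ext y
      simp [hB, Fin.forall_fin_succ, Fin.sum_univ_succ, and_assoc, Fin.tail]
    have hmeas : MeasurableSet B := by
      have : IsClosed B := by
        simp only [hB, Set.ofPred_and, Set.ofPred_forall]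
        refine (isClosed_le (by fun_prop) (by fun_prop)).inter
          ((isClosed_iInter fun i => isClosed_le (by fun_prop) (by fun_prop)).inter
            (isClosed_le (by fun_prop) (by fun_prop)))
      exact this.measurableSet
    have hslice (t : ℝ) : volume (Prod.mk t ⁻¹' B) =
        (Set.Icc 0 s).indicator (fun t => ENNReal.ofReal ((s - t) ^ n / n.factorial)) t := by
      by_cases ht : t ∈ Set.Icc 0 s
      · rw [Set.indicator_of_mem ht, ← ih (sub_nonneg.2 ht.2)]
        congr 1
        ext y
        simp [hB, ht.1, le_sub_iff_add_le']
      · rw [Set.indicator_of_notMem ht]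
        convert! measure_empty (μ := volume)
        refine Set.eq_empty_of_forall_notMem fun y hy => ht ⟨hy.1, ?_⟩
        have := Finset.sum_nonneg fun i (_ : i ∈ Finset.univ) => hy.2.1 i
        have := hy.2.2
        dsimp only at *
        linarith
    rw [hpre, (volume_preserving_piFinSuccAbove (fun _ => ℝ) 0).measure_preimage_equiv,
      Measure.volume_eq_prod, Measure.prod_apply hmeas]
    simp_rw [hslice]
    rw [lintegral_indicator measurableSet_Icc, ← ofReal_integral_eq_lintegral_ofReal]
    · rw [integral_Icc_eq_integral_Ioc, ← intervalIntegral.integral_of_le hs]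
      simp only [intervalIntegral.integral_div,
        intervalIntegral.integral_comp_sub_left (fun t => t ^ n), sub_self, sub_zero, integral_pow]
      congr 1
      rw [Nat.factorial_succ]
      push_cast
      field_simp
      simp
    · exact (by fun_prop : Continuous fun t : ℝ => (s - t) ^ n / n.factorial).integrableOn_Icc
    · filter_upwards [ae_restrict_mem measurableSet_Icc] with t ht
      have := sub_nonneg.2 ht.2
      positivity

/-- The hull is the image of the standard simplex under barycentric coordinates; eliminating the
weight of `x 0` leaves the corner simplex. -/
theorem convexHull_range_eq_image_corner_simplex {n : ℕ}
    (x : Fin (n + 1) → EuclideanSpace ℝ (Fin n)) :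
    convexHull ℝ (Set.range x) =
      (fun y => x 0 + y) '' (Matrix.toEuclideanLin (Matrix.of fun i j => x (Fin.succ j) i - x 0 i) ''
        (WithLp.ofLp ⁻¹' {y : Fin n → ℝ | (∀ i, 0 ≤ y i) ∧ ∑ i, y i ≤ 1})) := by
  have h : convexHull ℝ (Set.range x) = Fintype.linearCombination ℝ x '' stdSimplex ℝ (Fin (n + 1)) := by
    rw [← convexHull_rangle_single_eq_stdSimplex, LinearMap.image_convexHull, ← Set.range_comp]
    congr 2
    ext1 i
    simp
  have key (c : ℝ) (y : Fin n → ℝ) (hc : c + ∑ i, y i = 1) :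
      c • x 0 + ∑ i, y i • x i.succ = x 0 + Matrix.toEuclideanLin
        (Matrix.of fun i j => x (Fin.succ j) i - x 0 i) (WithLp.toLp 2 y) := by
    obtain rfl : c = 1 - ∑ i, y i := by linarith
    ext i
    simp only [PiLp.add_apply, PiLp.smul_apply, WithLp.ofLp_sum, WithLp.ofLp_smul,
      Finset.sum_apply, Pi.smul_apply, smul_eq_mul, Matrix.toLpLin_toLp, Matrix.toLin'_apply,
      Matrix.mulVec, dotProduct, Matrix.of_apply, sub_mul, Finset.sum_sub_distrib,
      ← Finset.mul_sum]
    simp only [mul_comm (y _)]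
    ring
  rw [h]
  ext z
  simp only [Set.mem_image, exists_exists_and_eq_and, Fintype.linearCombination_apply,
    Fin.sum_univ_succ]
  constructor
  · rintro ⟨w, ⟨hw0, hw1⟩, rfl⟩
    rw [Fin.sum_univ_succ] at hw1
    refine ⟨WithLp.toLp 2 fun i => w i.succ, ⟨fun i => hw0 _, ?_⟩, (key _ _ hw1).symm⟩
    have := hw0 0
    change ∑ i : Fin n, w i.succ ≤ 1
    linarith
  · rintro ⟨y, ⟨hy0, hy1⟩, rfl⟩
    -- The weight of `x 0` is whatever remains to reach total 1.
    refine ⟨Fin.cons (1 - ∑ i, y i) y.ofLp, ⟨fun i => ?_, ?_⟩, ?_⟩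
    · refine Fin.cases ?_ (fun j => ?_) i
      · simpa using hy1
      · simpa using hy0 j
    · simp [Fin.sum_univ_succ]
    · simpa using key (1 - ∑ i, y i) y.ofLp (by ring)

theorem volume_convexHull_range {n : ℕ} (x : Fin (n + 1) → EuclideanSpace ℝ (Fin n)) :
    MeasureTheory.volume.real (convexHull ℝ (Set.range x)) =
      |(Matrix.of fun i j => x (Fin.succ j) i - x 0 i).det| / n.factorial := by
  have hdet (A : Matrix (Fin n) (Fin n) ℝ) : LinearMap.det (Matrix.toEuclideanLin A) = A.det := by
    rw [Matrix.toEuclideanLin, Matrix.toLpLin_eq_toLin, LinearMap.det_toLin]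
  rw [convexHull_range_eq_image_corner_simplex, MeasureTheory.measureReal_def,
    Set.image_add_left, MeasureTheory.measure_preimage_add,
    MeasureTheory.Measure.addHaar_image_linearMap, hdet,
    (PiLp.volume_preserving_ofLp (Fin n)).measure_preimage_emb
      (MeasurableEquiv.toLp 2 (Fin n → ℝ)).symm.measurableEmbedding,
    MeasureTheory.volume_corner_simplex n zero_le_one, ← ENNReal.ofReal_mul (abs_nonneg _),
    ENNReal.toReal_ofReal (by positivity)]
  ring

/-! ### Inequalities, the volume term and homogeneity -/

namespace Atiyah

theorem d3_nonneg {a b c : ℝ} (h1 : c ≤ a + b) (h2 : a ≤ b + c) (h3 : b ≤ c + a) :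
    0 ≤ d3 a b c :=
  mul_nonneg (mul_nonneg (by linarith) (by linarith)) (by linarith)

theorem d3_le_mul {a b c : ℝ} (ha : 0 ≤ a) (hb : 0 ≤ b) (hc : 0 ≤ c) :
    d3 a b c ≤ a * b * c := by
  have key (a b c : ℝ) (hc : 0 ≤ c) (hab : b ≤ a) (hbc : c ≤ b) : d3 a b c ≤ a * b * c := by
    unfold d3
    -- For a ≥ b ≥ c ≥ 0, abc - d₃ = (a - b)²(a + b - c) + c(a - c)(b - c).
    nlinarith [mul_nonneg (sq_nonneg (a - b)) (by linarith : 0 ≤ a + b - c),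
      mul_nonneg hc (mul_nonneg (sub_nonneg.2 hbc) (sub_nonneg.2 (hbc.trans hab)))]
  have h1 : d3 a b c = d3 b a c := by unfold d3; ring
  have h2 : d3 a b c = d3 a c b := by unfold d3; ring
  have h3 : d3 a b c = d3 b c a := by unfold d3; ring
  have h4 : d3 a b c = d3 c a b := by unfold d3; ring
  have h5 : d3 a b c = d3 c b a := by unfold d3; ring
  rcases le_total a b with h | h <;> rcases le_total b c with h' | h' <;>
    rcases le_total a c with h'' | h''
  all_goals first
    | linarith [key a b c hc h h']
    | linarith [key b a c hc h h'']
    | linarith [key a c b hb h'' h']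
    | linarith [key b c a ha h' h'']
    | linarith [key c a b hb h'' h]
    | linarith [key c b a ha h' h]

theorem faceValue_nonneg (x : Fin 4 → Space) : 0 ≤ faceValue x := by
  refine mul_nonneg (mul_nonneg dist_nonneg (sub_nonneg.2 ?_)) (d3_nonneg ?_ ?_ ?_)
  · have := dist_triangle_left (x 2) (x 1) (x 3)
    gcongr
    linarith
  · linarith [dist_triangle_right (x 2) (x 1) (x 0)]
  · linarith [dist_triangle_left (x 1) (x 0) (x 2)]
  · linarith [dist_triangle (x 2) (x 1) (x 0)]

/-- V = |det| / 3!, so 144V² = 4 det², the value found in `eval_volPoly`. -/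
theorem tetraVolume_sq (x : Fin 4 → Space) :
    144 * tetraVolume x ^ 2 = MvPolynomial.eval (edgeLength x) volPoly := by
  rw [eval_volPoly, tetraVolume, volume_convexHull_range, div_pow, sq_abs]
  norm_num [Nat.factorial]
  ring

theorem isHomogeneous_r (i j : Fin 4) (h : i ≠ j) : (r i j h).IsHomogeneous 1 :=
  MvPolynomial.isHomogeneous_X _ _

theorem isHomogeneous_d3 {p q s : MvPolynomial Edge ℝ} {n : ℕ} (hp : p.IsHomogeneous n)
    (hq : q.IsHomogeneous n) (hs : s.IsHomogeneous n) : (d3 p q s).IsHomogeneous (n + n + n) :=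
  (((hp.add hq).sub hs).mul ((hq.add hs).sub hp)).mul ((hs.add hp).sub hq)

theorem isHomogeneous_facePoly : facePoly.IsHomogeneous 6 := by
  have h (i j h) := isHomogeneous_r i j h
  exact ((h _ _ _).mul ((((h _ _ _).add (h _ _ _)).pow 2).sub ((h _ _ _).pow 2))).mul
    (isHomogeneous_d3 (h _ _ _) (h _ _ _) (h _ _ _))

theorem isHomogeneous_av {p : MvPolynomial Edge ℝ} {n : ℕ} (hp : p.IsHomogeneous n) :
    (av p).IsHomogeneous n := by
  have := (MvPolynomial.isHomogeneous_C Edge (1 / 24 : ℝ)).mul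
    (MvPolynomial.IsHomogeneous.sum Finset.univ
      (fun g : Equiv.Perm (Fin 4) => MvPolynomial.rename (permEdge g) p) n
      fun g _ => hp.rename_isHomogeneous)
  rwa [zero_add] at this

theorem isHomogeneous_volPoly : volPoly.IsHomogeneous 6 := by
  have hsub {p q : MvPolynomial Edge ℝ} (hp : p.IsHomogeneous 6) (hq : q.IsHomogeneous 6) :
      (p - q).IsHomogeneous 6 := hp.sub hq
  -- The leading minus sign of `volPoly` binds to its first factor only.
  have hneg (i j h k l h') : (-r i j h ^ 4 * r k l h' ^ 2).IsHomogeneous 6 :=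
    ((isHomogeneous_r i j h).pow 4).neg.mul ((isHomogeneous_r k l h').pow 2)
  have h42 (i j h k l h') : (r i j h ^ 4 * r k l h' ^ 2).IsHomogeneous 6 :=
    ((isHomogeneous_r i j h).pow 4).mul ((isHomogeneous_r k l h').pow 2)
  have h24 (i j h k l h') : (r i j h ^ 2 * r k l h' ^ 4).IsHomogeneous 6 :=
    ((isHomogeneous_r i j h).pow 2).mul ((isHomogeneous_r k l h').pow 4)
  have h222 (i j h k l h' m n h'') :
      (r i j h ^ 2 * r k l h' ^ 2 * r m n h'' ^ 2).IsHomogeneous 6 :=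
    (((isHomogeneous_r i j h).pow 2).mul ((isHomogeneous_r k l h').pow 2)).mul
      ((isHomogeneous_r m n h'').pow 2)
  unfold volPoly
  repeat' first
    | with_reducible exact h42 _ _ _ _ _ _
    | with_reducible exact hneg _ _ _ _ _ _
    | with_reducible exact h24 _ _ _ _ _ _
    | with_reducible exact h222 _ _ _ _ _ _ _ _ _
    | with_reducible refine MvPolynomial.IsHomogeneous.add ?_ ?_
    | with_reducible refine hsub ?_ ?_

theorem isHomogeneous_natCast_mul {p : MvPolynomial Edge ℝ} {n : ℕ} (k : ℕ) [k.AtLeastTwo]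
    (hp : p.IsHomogeneous n) : ((OfNat.ofNat k : MvPolynomial Edge ℝ) * p).IsHomogeneous n := by
  have := (MvPolynomial.isHomogeneous_C Edge (OfNat.ofNat k : ℝ)).mul hp
  rwa [zero_add, map_ofNat] at this

theorem isHomogeneous_reDetPoly : reDetPoly.IsHomogeneous 6 := by
  have h (i j h) := isHomogeneous_r i j h
  refine (((isHomogeneous_natCast_mul 64 ?_).sub (isHomogeneous_natCast_mul 4 ?_)).add
    (isHomogeneous_natCast_mul 12 (isHomogeneous_av isHomogeneous_facePoly))).add
    (isHomogeneous_natCast_mul 2 isHomogeneous_volPoly)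
  · exact (((((h _ _ _).mul (h _ _ _)).mul (h _ _ _)).mul (h _ _ _)).mul (h _ _ _)).mul (h _ _ _)
  · exact isHomogeneous_d3 ((h _ _ _).mul (h _ _ _)) ((h _ _ _).mul (h _ _ _))
      ((h _ _ _).mul (h _ _ _))

end Atiyah

/-! ### The main theorem -/

theorem mainTheorem1 :
    Atiyah.reDetPoly.IsHomogeneous 6 ∧
    ∀ (x : Fin 4 → EuclideanSpace ℝ (Fin 3)), Function.Injective x →
    ∀ (w : Fin 4 → Fin 4 → ℂ × ℂ), Atiyah.IsHopfLift x w →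
      Atiyah.atiyahDet w ≠ 0 ∧
      (Atiyah.atiyahDet w).re = MvPolynomial.eval (Atiyah.edgeLength x) Atiyah.reDetPoly ∧
      (Atiyah.atiyahDet w).re =
        64 * (dist (x 1) (x 0) * dist (x 2) (x 0) * dist (x 2) (x 1)
            * dist (x 3) (x 0) * dist (x 3) (x 1) * dist (x 3) (x 2))
        - 4 * Atiyah.d3 (dist (x 1) (x 0) * dist (x 3) (x 2))
            (dist (x 2) (x 0) * dist (x 3) (x 1)) (dist (x 2) (x 1) * dist (x 3) (x 0))
        + 12 * MvPolynomial.eval (Atiyah.edgeLength x) (Atiyah.av Atiyah.facePoly)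
        + 288 * Atiyah.tetraVolume x ^ 2 ∧
      144 * Atiyah.tetraVolume x ^ 2 =
        MvPolynomial.eval (Atiyah.edgeLength x) Atiyah.volPoly ∧
      60 * (dist (x 1) (x 0) * dist (x 2) (x 0) * dist (x 2) (x 1)
          * dist (x 3) (x 0) * dist (x 3) (x 1) * dist (x 3) (x 2))
        ≤ (Atiyah.atiyahDet w).re ∧
      0 < 60 * (dist (x 1) (x 0) * dist (x 2) (x 0) * dist (x 2) (x 1)
          * dist (x 3) (x 0) * dist (x 3) (x 1) * dist (x 3) (x 2)) := by
  refine ⟨Atiyah.isHomogeneous_reDetPoly, fun x hx w hw => ?_⟩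
  have hre := Atiyah.re_atiyahDet_eq_eval x w hw
  have hvol := Atiyah.tetraVolume_sq x
  have hre' := hre
  simp only [Atiyah.reDetPoly, map_add, map_sub, map_mul, Atiyah.map_d3, Atiyah.eval_r,
    map_ofNat, ← hvol] at hre'
  have hpos {i j : Fin 4} (h : i ≠ j) : 0 < dist (x i) (x j) := dist_pos.2 (hx.ne h)
  have h10 := hpos (show (1 : Fin 4) ≠ 0 by decide)
  have h20 := hpos (show (2 : Fin 4) ≠ 0 by decide)
  have h21 := hpos (show (2 : Fin 4) ≠ 1 by decide)
  have h30 := hpos (show (3 : Fin 4) ≠ 0 by decide)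
  have h31 := hpos (show (3 : Fin 4) ≠ 1 by decide)
  have h32 := hpos (show (3 : Fin 4) ≠ 2 by decide)
  have hprod : 0 < 60 * (dist (x 1) (x 0) * dist (x 2) (x 0) * dist (x 2) (x 1)
      * dist (x 3) (x 0) * dist (x 3) (x 1) * dist (x 3) (x 2)) := by positivity
  -- The product of the three arguments is the product of all six distances.
  have hd3 := Atiyah.d3_le_mul (mul_pos h10 h32).le (mul_pos h20 h31).le (mul_pos h21 h30).le
  have hav : 0 ≤ MvPolynomial.eval (Atiyah.edgeLength x) (Atiyah.av Atiyah.facePoly) := by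
    rw [Atiyah.eval_av_facePoly]
    exact mul_nonneg (by norm_num) (Finset.sum_nonneg fun g _ => Atiyah.faceValue_nonneg _)
  have hle : 60 * (dist (x 1) (x 0) * dist (x 2) (x 0) * dist (x 2) (x 1)
      * dist (x 3) (x 0) * dist (x 3) (x 1) * dist (x 3) (x 2)) ≤ (Atiyah.atiyahDet w).re := by
    rw [hre']
    linarith [sq_nonneg (Atiyah.tetraVolume x)]
  refine ⟨fun h0 => ?_, hre, by rw [hre']; ring, hvol, hle, hprod⟩
  rw [h0, Complex.zero_re] at hle
  linarith
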